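/- Let $p\ge 1$ be an integer and let $\mu$ be a Borel probability measure on $\mathbb{R}^{d\times d}$ with compact support. Let $A$ be a random matrix with law $\mu$ and let $A_0,A_1,\dots$ be independent random matrices with law $\mu$. Consider the system $\Sigma_\mu:\ x(k+1)=A_kx(k)$, and denote its solution with $x(0)=x_0\in\mathbb{R}^d$ by $x(k;x_0)$. For a norm $\|\cdot\|$ on $\mathbb{R}^d$, $\Sigma_\mu$ is called exponentially stable in $p$th mean if there are $M,\beta>0$ with $E[\|x(k;x_0)\|^p]\le Me^{-\beta k}\|x_0\|^p$ for all $x_0\in\mathbb{R}^d$ and all $k\ge 0$. A Lyapunov function for $\Sigma_\mu$ is a continuous function $V:\mathbb{R}^d\to\mathbb{R}$ with $V(0)=0$ and $V(x)>0$ for $x\ne 0$, such that for some $0\le\gamma<1$ one has $E[V(Ax)]\le\gamma V(x)$ for all $x\in\mathbb{R}^d$. A cone (a set closed under multiplication by nonnegative scalars) $K\subset\mathbb{R}^d$ is proper if it is closed, convex, has nonempty interior, and $x,-x\in K$ implies $x=0$. Let $M^{\otimes p}$ denote the $p$th Kronecker power of a matrix $M$, and let $\tilde K_p\subset\mathbb{R}^{d^p}$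 be the closed convex hull of $\{x_1\otimes\cdots\otimes x_p : x_1,\dots,x_p\in K\}$. **Theorem.** Assume that either (a) $p$ is even, or (b) there is a proper cone $K\subset\mathbb{R}^d$ such that $MK\subset K$ for every $M\in\operatorname{supp}\mu$, and $E[A^{\otimes p}]$ is $\tilde K_p$-positive, i.e. $E[A^{\otimes p}](\tilde K_p\setminus\{0\})\subset\operatorname{int}\tilde K_p$. Then, for every norm on $\mathbb{R}^d$, $\Sigma_\mu$ is exponentially stable in $p$th mean if and only if it admits a Lyapunov function that is homogeneous of degree $p$. This equivalence holds both when homogeneity of degree $p$ means $V(ax)=a^pV(x)$ for all real $a\ge 0$ and all $x\in\mathbb{R}^d$, and when it means $V(ax)=|a|^pV(x)$ for all $a\in\mathbb{R}$ and all $x\in\mathbb{R}^d$. -/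

import Mathlib

open MeasureTheory ProbabilityTheory
open scoped Matrix

namespace SwitchedSystem

noncomputable section

/-- Matrices carry the Borel sigma-algebra. -/
instance instMeasurableSpaceMatrix {d : ℕ} : MeasurableSpace (Matrix (Fin d) (Fin d) ℝ) :=
  borel _

instance instBorelSpaceMatrix {d : ℕ} : BorelSpace (Matrix (Fin d) (Fin d) ℝ) := ⟨rfl⟩

/-- The solution `x(k; x₀)` of the switched linear system `x(k+1) = A_k x(k)`, `x(0) = x₀`. -/
def solution {Ω : Type*} {d : ℕ} (A : ℕ → Ω → Matrix (Fin d) (Fin d) ℝ) (x₀ : Fin d → ℝ) :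
    ℕ → Ω → (Fin d → ℝ)
  | 0, _ => x₀
  | k + 1, ω => A k ω *ᵥ solution A x₀ k ω

/-- Exponential stability in the `p`th mean of `x(k+1) = A_k x(k)`, with respect to the norm `N`.
The integrability clause says that the expected value is a genuine (finite) one. -/
def IsMeanStable {Ω : Type*} [MeasurableSpace Ω] {d : ℕ} (P : Measure Ω)
    (A : ℕ → Ω → Matrix (Fin d) (Fin d) ℝ) (N : (Fin d → ℝ) → ℝ) (p : ℕ) : Prop :=
  ∃ M > (0 : ℝ), ∃ β > (0 : ℝ), ∀ (x₀ : Fin d → ℝ) (k : ℕ),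
    Integrable (fun ω => N (solution A x₀ k ω) ^ p) P ∧
      ∫ ω, N (solution A x₀ k ω) ^ p ∂P ≤ M * Real.exp (-β * k) * N x₀ ^ p

/-- `V` is a Lyapunov function for the system whose matrices are i.i.d. with law `μ`. -/
structure IsLyapunov {d : ℕ} (μ : Measure (Matrix (Fin d) (Fin d) ℝ))
    (V : (Fin d → ℝ) → ℝ) : Prop where
  continuous : Continuous V
  map_zero : V 0 = 0
  pos : ∀ x, x ≠ 0 → 0 < V x
  decrease : ∃ γ : ℝ, 0 ≤ γ ∧ γ < 1 ∧ ∀ x : Fin d → ℝ,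
    Integrable (fun A : Matrix (Fin d) (Fin d) ℝ => V (A *ᵥ x)) μ ∧
      ∫ A, V (A *ᵥ x) ∂μ ≤ γ * V x

/-- Homogeneity of degree `p` with respect to nonnegative scalars. -/
def IsPosHomogeneous {d : ℕ} (p : ℕ) (V : (Fin d → ℝ) → ℝ) : Prop :=
  ∀ a : ℝ, 0 ≤ a → ∀ x, V (a • x) = a ^ p * V x

/-- Absolute homogeneity of degree `p`, with respect to all real scalars. -/
def IsAbsHomogeneous {d : ℕ} (p : ℕ) (V : (Fin d → ℝ) → ℝ) : Prop :=
  ∀ (a : ℝ) (x), V (a • x) = |a| ^ p * V x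

/-- A proper cone in `ℝ^ι`: a closed convex cone that is solid and pointed (contains no line). -/
structure IsProperCone {ι : Type*} (K : Set (ι → ℝ)) : Prop where
  smul_mem : ∀ a : ℝ, 0 ≤ a → ∀ x ∈ K, a • x ∈ K
  isClosed : IsClosed K
  convex : Convex ℝ K
  solid : (interior K).Nonempty
  pointed : ∀ x, x ∈ K → -x ∈ K → x = 0

/-- The matrix `M` leaves `K` invariant: `M K ⊆ K`. -/
def LeavesInvariant {ι : Type*} [Fintype ι] (M : Matrix ι ι ℝ) (K : Set (ι → ℝ)) : Prop :=
  ∀ x ∈ K, M *ᵥ x ∈ K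

/-- The matrix `M` is `K`-positive: `M (K - {0}) ⊆ int K`. -/
def IsConePositive {ι : Type*} [Fintype ι] (M : Matrix ι ι ℝ) (K : Set (ι → ℝ)) : Prop :=
  ∀ x ∈ K, x ≠ 0 → M *ᵥ x ∈ interior K

/-- The Kronecker power `M^{⊗p}`; the `d^p` rows and columns are indexed by the multi-indices
`Fin p → Fin d`. -/
def kronPow {d : ℕ} (p : ℕ) (M : Matrix (Fin d) (Fin d) ℝ) :
    Matrix (Fin p → Fin d) (Fin p → Fin d) ℝ :=
  Matrix.of fun i j => ∏ l, M (i l) (j l)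

/-- The (entrywise) expected value `E[A^{⊗p}]`, where `A` has law `μ`. -/
def meanKronPow {d : ℕ} (p : ℕ) (μ : Measure (Matrix (Fin d) (Fin d) ℝ)) :
    Matrix (Fin p → Fin d) (Fin p → Fin d) ℝ :=
  Matrix.of fun i j => ∫ A, kronPow p A i j ∂μ

/-- The Kronecker product `x₁ ⊗ ⋯ ⊗ x_p` of `p` vectors of `ℝ^d`, as an element of `ℝ^(d^p)`. -/
def kronVec {d p : ℕ} (x : Fin p → Fin d → ℝ) : (Fin p → Fin d) → ℝ :=
  fun i => ∏ l, x l (i l)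

/-- The closed convex hull in `ℝ^(d^p)` of the products `x₁ ⊗ ⋯ ⊗ x_p` with all `x_l ∈ K`. -/
def tensorCone {d : ℕ} (p : ℕ) (K : Set (Fin d → ℝ)) : Set ((Fin p → Fin d) → ℝ) :=
  closure (convexHull ℝ {z | ∃ x : Fin p → Fin d → ℝ, (∀ l, x l ∈ K) ∧ z = kronVec x})

end

end SwitchedSystem

namespace SwitchedSystem

variable {d : ℕ}

/-! Let `T f x = E[f (A x)]` be the transition operator. Independence gives `E[f (x(k; x₀))] = T^k f
x₀` (`integrable_and_integral_comp_solution`), so with `f = N ^ p` stability says that `T^k f ≤ M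
e^{-βk} f` pointwise. Given this decay, `V = ∑_{k<n} T^k f` telescopes to `T V = V - f + T^n f`; for
`n` large the drop is at least `f / 2`, hence at least a fixed fraction of `V`. Conversely, `T V ≤ γ
V` iterates to `T^k V ≤ γ^k V`, and by homogeneity and compactness of the sphere `V` and `f` bound
each other up to constants. Since `V` inherits absolute homogeneity from `f`, while the converse
needs only positive homogeneity, both conventions are covered. -/

instance instSecondCountableTopologyMatrix :
    SecondCountableTopology (Matrix (Fin d) (Fin d) ℝ) :=
  inferInstanceAs (SecondCountableTopology (Fin d → Fin d → ℝ))

/-- The transition operator `f ↦ (x ↦ E[f (A x)])`, where `A` has law `μ`. -/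
noncomputable def transition (μ : Measure (Matrix (Fin d) (Fin d) ℝ)) (f : (Fin d → ℝ) → ℝ) :
    (Fin d → ℝ) → ℝ :=
  fun x => ∫ M, f (M *ᵥ x) ∂μ

/-! ### The transition operator and its iterates -/

section Transition

lemma restrict_support_eq {μ : Measure (Matrix (Fin d) (Fin d) ℝ)} : μ.restrict μ.support = μ :=
  Measure.restrict_eq_self_of_ae_mem Measure.support_mem_ae

variable {μ : Measure (Matrix (Fin d) (Fin d) ℝ)} [IsProbabilityMeasure μ]

lemma integrable_of_isCompact_support (hμ : IsCompact μ.support)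
    {g : Matrix (Fin d) (Fin d) ℝ → ℝ} (hg : Continuous g) : Integrable g μ := by
  have h : IntegrableOn g μ.support μ := hg.continuousOn.integrableOn_compact hμ
  rwa [IntegrableOn, restrict_support_eq] at h

lemma continuous_mulVec_right (x : Fin d → ℝ) :
    Continuous fun M : Matrix (Fin d) (Fin d) ℝ => M *ᵥ x :=
  continuous_id.matrix_mulVec continuous_const

/-- The integral only sees the compact support, where a jointly continuous integrand depends
continuously on its parameter. -/
lemma continuous_transition (hμ : IsCompact μ.support) {f : (Fin d → ℝ) → ℝ}
    (hf : Continuous f) : Continuous (transition μ f) := by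
  have h : Continuous fun x : Fin d → ℝ => ∫ M in μ.support, f (M *ᵥ x) ∂μ :=
    continuous_parametric_integral_of_continuous
      (f := fun (x : Fin d → ℝ) (M : Matrix (Fin d) (Fin d) ℝ) => f (M *ᵥ x))
      (hf.comp (continuous_snd.matrix_mulVec continuous_fst)) hμ
  simp only [restrict_support_eq] at h
  exact h

lemma integrable_comp_mulVec (hμ : IsCompact μ.support) {f : (Fin d → ℝ) → ℝ}
    (hf : Continuous f) (x : Fin d → ℝ) :
    Integrable (fun M : Matrix (Fin d) (Fin d) ℝ => f (M *ᵥ x)) μ :=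
  integrable_of_isCompact_support hμ (hf.comp (continuous_mulVec_right x))

lemma continuous_iterate_transition (hμ : IsCompact μ.support) {f : (Fin d → ℝ) → ℝ}
    (hf : Continuous f) (k : ℕ) : Continuous ((transition μ)^[k] f) := by
  induction k with
  | zero => exact hf
  | succ k ih => rw [Function.iterate_succ_apply']; exact continuous_transition hμ ih

lemma transition_finset_sum (hμ : IsCompact μ.support) {ι : Type*} (s : Finset ι)
    {f : ι → (Fin d → ℝ) → ℝ} (hf : ∀ i ∈ s, Continuous (f i)) (x : Fin d → ℝ) :
    transition μ (fun y => ∑ i ∈ s, f i y) x = ∑ i ∈ s, transition μ (f i) x :=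
  integral_finsetSum s fun i hi => integrable_comp_mulVec hμ (hf i hi) x

lemma transition_mono (hμ : IsCompact μ.support) {f g : (Fin d → ℝ) → ℝ} (hf : Continuous f)
    (hg : Continuous g) (hfg : ∀ x, f x ≤ g x) (x : Fin d → ℝ) :
    transition μ f x ≤ transition μ g x :=
  integral_mono (integrable_comp_mulVec hμ hf x) (integrable_comp_mulVec hμ hg x)
    fun M => hfg (M *ᵥ x)

lemma transition_const_mul {μ : Measure (Matrix (Fin d) (Fin d) ℝ)} (c : ℝ)
    (f : (Fin d → ℝ) → ℝ) (x : Fin d → ℝ) :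
    transition μ (fun y => c * f y) x = c * transition μ f x :=
  integral_const_mul c _

lemma iterate_transition_mono (hμ : IsCompact μ.support) {f g : (Fin d → ℝ) → ℝ}
    (hf : Continuous f) (hg : Continuous g) (hfg : ∀ x, f x ≤ g x) (k : ℕ) (x : Fin d → ℝ) :
    (transition μ)^[k] f x ≤ (transition μ)^[k] g x := by
  induction k generalizing x with
  | zero => exact hfg x
  | succ k ih =>
    simp only [Function.iterate_succ_apply']
    exact transition_mono hμ (continuous_iterate_transition hμ hf k)
      (continuous_iterate_transition hμ hg k) ih x

lemma iterate_transition_const_mul {μ : Measure (Matrix (Fin d) (Fin d) ℝ)} (c : ℝ)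
    (f : (Fin d → ℝ) → ℝ) (k : ℕ) (x : Fin d → ℝ) :
    (transition μ)^[k] (fun y => c * f y) x = c * (transition μ)^[k] f x := by
  induction k generalizing x with
  | zero => rfl
  | succ k ih =>
    simp only [Function.iterate_succ_apply']
    rw [← transition_const_mul]
    exact congrArg (fun g => transition μ g x) (funext ih)

lemma iterate_transition_le (hμ : IsCompact μ.support) {V : (Fin d → ℝ) → ℝ}
    (hV : Continuous V) {γ : ℝ} (hγ : 0 ≤ γ) (h : ∀ x, transition μ V x ≤ γ * V x)
    (k : ℕ) (x : Fin d → ℝ) : (transition μ)^[k] V x ≤ γ ^ k * V x := by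
  induction k with
  | zero => simp
  | succ k ih =>
    rw [Function.iterate_succ_apply]
    calc (transition μ)^[k] (transition μ V) x
        ≤ (transition μ)^[k] (fun y => γ * V y) x :=
          iterate_transition_mono hμ (continuous_transition hμ hV) (hV.const_mul γ) h k x
      _ = γ * (transition μ)^[k] V x := iterate_transition_const_mul γ V k x
      _ ≤ γ * (γ ^ k * V x) := mul_le_mul_of_nonneg_left ih hγ
      _ = γ ^ (k + 1) * V x := by ring

lemma iterate_transition_nonneg {μ : Measure (Matrix (Fin d) (Fin d) ℝ)} {f : (Fin d → ℝ) → ℝ}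
    (hf : ∀ x, 0 ≤ f x) (k : ℕ) (x : Fin d → ℝ) : 0 ≤ (transition μ)^[k] f x := by
  induction k generalizing x with
  | zero => exact hf x
  | succ k ih =>
    rw [Function.iterate_succ_apply']
    exact integral_nonneg fun M => ih (M *ᵥ x)

lemma isAbsHomogeneous_iterate_transition {μ : Measure (Matrix (Fin d) (Fin d) ℝ)} {p : ℕ}
    {f : (Fin d → ℝ) → ℝ} (hf : IsAbsHomogeneous p f) (k : ℕ) : IsAbsHomogeneous p ((transition μ)^[k] f) := by
  induction k with
  | zero => exact hf
  | succ k ih =>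
    intro a x
    simp only [Function.iterate_succ_apply']
    rw [← transition_const_mul]
    simp only [transition, Matrix.mulVec_smul]
    exact integral_congr_ae (.of_forall fun M => ih a (M *ᵥ x))

end Transition

/-! ### Comparison of homogeneous functions -/

lemma IsAbsHomogeneous.isPosHomogeneous {p : ℕ} {V : (Fin d → ℝ) → ℝ}
    (hV : IsAbsHomogeneous p V) : IsPosHomogeneous p V := fun a ha x => by
  rw [hV a x, abs_of_nonneg ha]

/-- The quotient `W / V` is continuous, hence bounded, on the compact unit sphere; scaling extends
the bound, and at `0` both functions vanish because `p ≠ 0`. -/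
lemma IsPosHomogeneous.exists_le_mul {p : ℕ} (hp : p ≠ 0) {V W : (Fin d → ℝ) → ℝ}
    (hV : IsPosHomogeneous p V) (hW : IsPosHomogeneous p W) (hVc : Continuous V)
    (hWc : Continuous W) (hVpos : ∀ x, x ≠ 0 → 0 < V x) :
    ∃ C > (0 : ℝ), ∀ x, W x ≤ C * V x := by
  have hVne : ∀ x ∈ Metric.sphere (0 : Fin d → ℝ) 1, V x ≠ 0 := fun x hx =>
    (hVpos x (ne_zero_of_mem_unit_sphere ⟨x, hx⟩)).ne'
  obtain ⟨C, hC⟩ := (isCompact_sphere (0 : Fin d → ℝ) 1).exists_bound_of_continuousOn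
    (hWc.continuousOn.div hVc.continuousOn hVne)
  refine ⟨max C 1, by positivity, fun x => ?_⟩
  rcases eq_or_ne x 0 with rfl | hx
  · have hV0 := hV 0 le_rfl 0
    have hW0 := hW 0 le_rfl 0
    simp only [smul_zero, zero_pow hp, zero_mul] at hV0 hW0
    simp [hV0, hW0]
  · have hn : 0 < ‖x‖ := norm_pos_iff.2 hx
    set u : Fin d → ℝ := ‖x‖⁻¹ • x with hu
    have hus : u ∈ Metric.sphere (0 : Fin d → ℝ) 1 := by
      simp [hu, norm_smul, hn.ne']
    have hxu : x = ‖x‖ • u := by rw [hu, smul_inv_smul₀ hn.ne']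
    have hVu : 0 < V u := hVpos u (ne_zero_of_mem_unit_sphere ⟨u, hus⟩)
    have hle : W u ≤ max C 1 * V u := by
      rw [← div_le_iff₀ hVu]
      exact ((le_abs_self _).trans (hC u hus)).trans (le_max_left _ _)
    rw [hxu, hV _ hn.le, hW _ hn.le, mul_left_comm]
    exact mul_le_mul_of_nonneg_left hle (by positivity)

lemma continuous_seminorm (N : Seminorm ℝ (Fin d → ℝ)) : Continuous N :=
  continuousOn_univ.1 (N.convexOn.continuousOn isOpen_univ)

lemma isAbsHomogeneous_seminorm_pow (N : Seminorm ℝ (Fin d → ℝ)) (p : ℕ) :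
    IsAbsHomogeneous p (fun x => N x ^ p) := fun a x => by
  simp only [map_smul_eq_mul, mul_pow, Real.norm_eq_abs]

/-! ### Expected values along random trajectories -/

section Solution

variable {Ω : Type*}

lemma solution_congr {Ω' : Type*} {A : ℕ → Ω → Matrix (Fin d) (Fin d) ℝ}
    {B : ℕ → Ω' → Matrix (Fin d) (Fin d) ℝ} (x₀ : Fin d → ℝ) {ω : Ω} {ω' : Ω'} {k : ℕ}
    (h : ∀ i < k, A i ω = B i ω') : solution A x₀ k ω = solution B x₀ k ω' := by
  induction k with
  | zero => rfl
  | succ k ih =>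
    rw [solution, solution, h k k.lt_succ_self, ih fun i hi => h i (hi.trans k.lt_succ_self)]

variable [MeasurableSpace Ω]

lemma measurable_solution {A : ℕ → Ω → Matrix (Fin d) (Fin d) ℝ}
    (hA : ∀ k, Measurable (A k)) (x₀ : Fin d → ℝ) (k : ℕ) :
    Measurable (solution A x₀ k) := by
  induction k with
  | zero => exact measurable_const
  | succ k ih =>
    have hc : Continuous fun q : Matrix (Fin d) (Fin d) ℝ × (Fin d → ℝ) => q.1 *ᵥ q.2 :=
      continuous_fst.matrix_mulVec continuous_snd
    exact hc.measurable.comp ((hA k).prodMk ih)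

variable {P : Measure Ω} {A : ℕ → Ω → Matrix (Fin d) (Fin d) ℝ}

/-- The state at time `k` is a measurable function of `A 0, …, A (k - 1)` alone. -/
lemma indepFun_solution (hA_meas : ∀ k, Measurable (A k)) (hA_indep : iIndepFun A P)
    (x₀ : Fin d → ℝ) (k : ℕ) : IndepFun (solution A x₀ k) (A k) P := by
  have hdisj : Disjoint (Finset.range k) {k} := by simp
  have h := hA_indep.indepFun_finset (Finset.range k) {k} hdisj hA_meas
  -- The default `0` is harmless: the state at time `k` never uses a matrix of index `≥ k`.
  let B : ℕ → (Finset.range k → Matrix (Fin d) (Fin d) ℝ) → Matrix (Fin d) (Fin d) ℝ :=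
    fun i v => if hi : i ∈ Finset.range k then v ⟨i, hi⟩ else 0
  have hB : ∀ i, Measurable (B i) := fun i => by
    by_cases hi : i ∈ Finset.range k
    · simp only [B, hi, dite_true]; exact measurable_pi_apply _
    · simp only [B, hi, dite_false]; exact measurable_const
  have h' := h.comp (measurable_solution hB x₀ k)
    (measurable_pi_apply (⟨k, Finset.mem_singleton_self k⟩ : ({k} : Finset ℕ)))
  have hsol : solution A x₀ k = solution B x₀ k ∘ fun ω (i : Finset.range k) => A i ω := by
    funext ω
    refine solution_congr x₀ fun i hi => ?_
    simp [B, hi]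
  rw [hsol]
  exact h'

/-- The expected value along the solution is given by the iterates of the transition operator. -/
lemma integrable_and_integral_comp_solution [IsProbabilityMeasure P]
    {μ : Measure (Matrix (Fin d) (Fin d) ℝ)} [IsProbabilityMeasure μ]
    (hμ : IsCompact μ.support) (hA_meas : ∀ k, Measurable (A k))
    (hA_indep : iIndepFun A P) (hA_law : ∀ k, P.map (A k) = μ) (x₀ : Fin d → ℝ) (k : ℕ)
    {f : (Fin d → ℝ) → ℝ} (hf : Continuous f) :
    Integrable (fun ω => f (solution A x₀ k ω)) P ∧
      ∫ ω, f (solution A x₀ k ω) ∂P = (transition μ)^[k] f x₀ := by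
  induction k generalizing f with
  | zero => simp [solution]
  | succ k ih =>
    have hX := measurable_solution hA_meas x₀ k
    set ν := P.map (solution A x₀ k) with hν
    have : IsProbabilityMeasure ν := Measure.isProbabilityMeasure_map hX.aemeasurable
    have hprod : P.map (fun ω => (solution A x₀ k ω, A k ω)) = ν.prod μ := by
      rw [(indepFun_iff_map_prod_eq_prod_map_map hX.aemeasurable (hA_meas k).aemeasurable).1
        (indepFun_solution hA_meas hA_indep x₀ k), hA_law k]
    have hpair : AEMeasurable (fun ω => (solution A x₀ k ω, A k ω)) P :=
      (hX.prodMk (hA_meas k)).aemeasurable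
    let F : (Fin d → ℝ) × Matrix (Fin d) (Fin d) ℝ → ℝ := fun q => f (q.2 *ᵥ q.1)
    have hF : Continuous F := hf.comp (continuous_snd.matrix_mulVec continuous_fst)
    have hFm : ∀ m : Measure ((Fin d → ℝ) × Matrix (Fin d) (Fin d) ℝ),
        AEStronglyMeasurable F m := fun m => hF.aestronglyMeasurable
    have hint : Integrable F (ν.prod μ) := by
      rw [integrable_prod_iff (hFm _)]
      refine ⟨.of_forall fun x => integrable_comp_mulVec hμ hf x, ?_⟩
      -- Fubini needs the inner integral of `‖f‖` to be integrable; this is the induction hypothesis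
      -- for `T ‖f‖`, whence the generalization over `f`.
      have hT : Continuous (transition μ fun y => ‖f y‖) := continuous_transition hμ hf.norm
      exact (integrable_map_measure hT.aestronglyMeasurable hX.aemeasurable).2 (ih hT).1
    refine ⟨?_, ?_⟩
    · rw [← hprod] at hint
      exact hint.comp_aemeasurable hpair
    · have hT : Continuous (transition μ f) := continuous_transition hμ hf
      calc ∫ ω, f (solution A x₀ (k + 1) ω) ∂P
          = ∫ q, F q ∂(P.map fun ω => (solution A x₀ k ω, A k ω)) :=
            (integral_map hpair (hFm _)).symm
        _ = ∫ x, transition μ f x ∂ν := by rw [hprod, integral_prod F hint]; rfl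
        _ = ∫ ω, transition μ f (solution A x₀ k ω) ∂P :=
            integral_map hX.aemeasurable hT.aestronglyMeasurable
        _ = (transition μ)^[k + 1] f x₀ := (ih hT).2

end Solution

/-! ### Decay of the iterates versus Lyapunov functions -/

/-- A truncated sum of the expected values along the trajectories is a Lyapunov function. -/
lemma exists_isLyapunov_isAbsHomogeneous {p : ℕ} {μ : Measure (Matrix (Fin d) (Fin d) ℝ)}
    [IsProbabilityMeasure μ] (hμ : IsCompact μ.support) {f : (Fin d → ℝ) → ℝ}
    (hf : Continuous f) (hf0 : f 0 = 0) (hfpos : ∀ x, x ≠ 0 → 0 < f x)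
    (hfhom : IsAbsHomogeneous p f) {a : ℕ → ℝ} (ha : Filter.Tendsto a Filter.atTop (nhds 0))
    (hfa : ∀ k x, (transition μ)^[k] f x ≤ a k * f x) :
    ∃ V : (Fin d → ℝ) → ℝ, IsLyapunov μ V ∧ IsAbsHomogeneous p V := by
  have hf_nonneg : ∀ x, 0 ≤ f x := fun x => by
    rcases eq_or_ne x 0 with rfl | hx
    exacts [hf0.ge, (hfpos x hx).le]
  -- `n ≥ 1` puts the term `f` itself into the sum, so that `f ≤ V`.
  obtain ⟨n, hn, hn1⟩ := ((ha.eventually (gt_mem_nhds (by norm_num : (0 : ℝ) < 1 / 2))).and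
    (Filter.eventually_ge_atTop 1)).exists
  let V : (Fin d → ℝ) → ℝ := fun x => ∑ k ∈ Finset.range n, (transition μ)^[k] f x
  let C : ℝ := max 1 (∑ k ∈ Finset.range n, a k)
  have hC : 1 ≤ C := le_max_left _ _
  have hVc : Continuous V :=
    continuous_finsetSum _ fun k _ => continuous_iterate_transition hμ hf k
  have hfV : ∀ x, f x ≤ V x := fun x =>
    Finset.single_le_sum (f := fun k => (transition μ)^[k] f x)
      (fun k _ => iterate_transition_nonneg hf_nonneg k x) (Finset.mem_range.2 hn1)
  have hVf : ∀ x, V x ≤ C * f x := fun x =>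
    calc V x ≤ ∑ k ∈ Finset.range n, a k * f x := Finset.sum_le_sum fun k _ => hfa k x
      _ = (∑ k ∈ Finset.range n, a k) * f x := (Finset.sum_mul _ _ _).symm
      _ ≤ C * f x := mul_le_mul_of_nonneg_right (le_max_right _ _) (hf_nonneg x)
  have hTV : ∀ x, transition μ V x = V x + (transition μ)^[n] f x - f x := fun x => by
    have h1 : transition μ V x = ∑ k ∈ Finset.range n, (transition μ)^[k + 1] f x := by
      simp only [Function.iterate_succ_apply']
      exact transition_finset_sum hμ _ (fun k _ => continuous_iterate_transition hμ hf k) x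
    have h2 := Finset.sum_range_succ (fun k => (transition μ)^[k] f x) n
    rw [Finset.sum_range_succ'] at h2
    simp only [Function.iterate_zero, id] at h2
    rw [h1]
    linarith
  -- The rate comes from `T V ≤ V - f / 2` and `V ≤ C f`; `C ≥ 1` keeps it nonnegative.
  refine ⟨V, ⟨hVc, ?_, fun x hx => (hfpos x hx).trans_le (hfV x), 1 - 1 / (2 * C), ?_, ?_,
    fun x => ⟨integrable_comp_mulVec hμ hVc x, ?_⟩⟩, fun b x => ?_⟩
  · have h1 := hfV 0
    have h2 := hVf 0
    rw [hf0] at h1 h2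
    linarith
  · rw [sub_nonneg, div_le_one (by positivity)]
    linarith
  · rw [sub_lt_self_iff]
    positivity
  · change transition μ V x ≤ _
    have h1 : (transition μ)^[n] f x ≤ 1 / 2 * f x :=
      (hfa n x).trans (mul_le_mul_of_nonneg_right hn.le (hf_nonneg x))
    have h2 : 1 / (2 * C) * V x ≤ 1 / 2 * f x := by
      rw [div_mul_eq_mul_div, one_mul, div_le_iff₀ (by positivity)]
      linarith [hVf x]
    rw [hTV x]
    linarith
  · simp only [V, Finset.mul_sum]
    exact Finset.sum_congr rfl fun k _ => isAbsHomogeneous_iterate_transition hfhom k b x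

lemma IsLyapunov.exists_iterate_transition_le {p : ℕ} (hp : p ≠ 0)
    {μ : Measure (Matrix (Fin d) (Fin d) ℝ)} [IsProbabilityMeasure μ]
    (hμ : IsCompact μ.support) {V f : (Fin d → ℝ) → ℝ} (hV : IsLyapunov μ V)
    (hVhom : IsPosHomogeneous p V) (hf : Continuous f) (hfpos : ∀ x, x ≠ 0 → 0 < f x)
    (hfhom : IsPosHomogeneous p f) (hf_nonneg : ∀ x, 0 ≤ f x) :
    ∃ M > (0 : ℝ), ∃ β > (0 : ℝ), ∀ x k,
      (transition μ)^[k] f x ≤ M * Real.exp (-β * k) * f x := by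
  obtain ⟨a, ha, hfV⟩ := hVhom.exists_le_mul hp hfhom hV.continuous hf hV.pos
  obtain ⟨b, hb, hVf⟩ := hfhom.exists_le_mul hp hVhom hf hV.continuous hfpos
  obtain ⟨γ, hγ0, hγ1, hdec⟩ := hV.decrease
  -- `γ` may be `0`; a positive rate is needed to set `β = -log δ`.
  let δ : ℝ := max γ (1 / 2)
  have hδ0 : 0 < δ := lt_max_of_lt_right (by norm_num)
  have hδ1 : δ < 1 := max_lt hγ1 (by norm_num)
  refine ⟨a * b, by positivity, -Real.log δ, neg_pos.2 (Real.log_neg hδ0 hδ1), fun x k => ?_⟩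
  have hexp : Real.exp (- -Real.log δ * k) = δ ^ k := by
    rw [neg_neg, mul_comm, Real.exp_nat_mul, Real.exp_log hδ0]
  rw [hexp]
  have hV_nonneg : 0 ≤ V x := nonneg_of_mul_nonneg_right ((hf_nonneg x).trans (hfV x)) ha
  calc (transition μ)^[k] f x
      ≤ (transition μ)^[k] (fun y => a * V y) x :=
        iterate_transition_mono hμ hf (hV.continuous.const_mul a) hfV k x
    _ = a * (transition μ)^[k] V x := iterate_transition_const_mul a V k x
    _ ≤ a * (γ ^ k * V x) := mul_le_mul_of_nonneg_left
        (iterate_transition_le hμ hV.continuous hγ0 (fun y => (hdec y).2) k x) ha.le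
    _ ≤ a * (δ ^ k * (b * f x)) := by
        gcongr
        · exact le_max_left _ _
        · exact hVf x
    _ = a * b * δ ^ k * f x := by ring

end SwitchedSystem

open SwitchedSystem in
theorem theorem1 {d p : ℕ} (hp : 0 < p)
    (μ : Measure (Matrix (Fin d) (Fin d) ℝ)) [IsProbabilityMeasure μ]
    (hμ : IsCompact μ.support)
    {Ω : Type*} [MeasurableSpace Ω] (P : Measure Ω) [IsProbabilityMeasure P]
    (A : ℕ → Ω → Matrix (Fin d) (Fin d) ℝ)
    (hA_meas : ∀ k, Measurable (A k))
    (hA_indep : iIndepFun A P)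
    (hA_law : ∀ k, P.map (A k) = μ)
    (N : Seminorm ℝ (Fin d → ℝ)) (hN : ∀ x, N x = 0 → x = 0)
    (h : Even p ∨
      ∃ K : Set (Fin d → ℝ), SwitchedSystem.IsProperCone K ∧
        (∀ M ∈ μ.support, SwitchedSystem.LeavesInvariant M K) ∧
        SwitchedSystem.IsConePositive (SwitchedSystem.meanKronPow p μ)
          (SwitchedSystem.tensorCone p K)) :
    (SwitchedSystem.IsMeanStable P A N p ↔
      ∃ V : (Fin d → ℝ) → ℝ,
        SwitchedSystem.IsLyapunov μ V ∧ SwitchedSystem.IsPosHomogeneous p V) ∧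
    (SwitchedSystem.IsMeanStable P A N p ↔
      ∃ V : (Fin d → ℝ) → ℝ,
        SwitchedSystem.IsLyapunov μ V ∧ SwitchedSystem.IsAbsHomogeneous p V) := by
  have hp' : p ≠ 0 := hp.ne'
  let f : (Fin d → ℝ) → ℝ := fun x => N x ^ p
  have hf : Continuous f := (continuous_seminorm N).pow p
  have hfhom : IsAbsHomogeneous p f := isAbsHomogeneous_seminorm_pow N p
  have hf_nonneg : ∀ x, 0 ≤ f x := fun x => pow_nonneg (apply_nonneg N x) p
  have hfpos : ∀ x, x ≠ 0 → 0 < f x := fun x hx =>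
    pow_pos (lt_of_le_of_ne (apply_nonneg N x) fun h0 => hx (hN x h0.symm)) p
  have hf0 : f 0 = 0 := by simp [f, hp']
  have hsol : ∀ (x₀ : Fin d → ℝ) (k : ℕ), _ := fun x₀ k =>
    integrable_and_integral_comp_solution hμ hA_meas hA_indep hA_law x₀ k hf
  have hconverse : IsMeanStable P A N p → ∃ V, IsLyapunov μ V ∧ IsAbsHomogeneous p V := by
    rintro ⟨M, -, β, hβ, hst⟩
    refine exists_isLyapunov_isAbsHomogeneous hμ hf hf0 hfpos hfhom
      (a := fun k : ℕ => M * Real.exp (-β * k)) ?_ fun k x => ?_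
    · have h1 : Filter.Tendsto (fun k : ℕ => -β * (k : ℝ)) Filter.atTop Filter.atBot :=
        tendsto_natCast_atTop_atTop.const_mul_atTop_of_neg (neg_neg_of_pos hβ)
      simpa using (Real.tendsto_exp_atBot.comp h1).const_mul M
    · rw [← (hsol x k).2]
      exact (hst x k).2
  have hdirect : ∀ V, IsLyapunov μ V → IsPosHomogeneous p V → IsMeanStable P A N p := by
    intro V hV hVhom
    obtain ⟨M, hM, β, hβ, hle⟩ := hV.exists_iterate_transition_le hp' hμ hVhom hf hfpos
      hfhom.isPosHomogeneous hf_nonneg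
    exact ⟨M, hM, β, hβ, fun x₀ k => ⟨(hsol x₀ k).1, (hsol x₀ k).2.trans_le (hle x₀ k)⟩⟩
  refine ⟨⟨fun hs => ?_, fun ⟨V, hV, hVhom⟩ => hdirect V hV hVhom⟩,
    ⟨hconverse, fun ⟨V, hV, hVhom⟩ => hdirect V hV hVhom.isPosHomogeneous⟩⟩
  obtain ⟨V, hV, hVhom⟩ := hconverse hs
  exact ⟨V, hV, hVhom.isPosHomogeneous⟩
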